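/- Let $\mathfrak o$ be a compact discrete valuation ring (equivalently, a complete discrete valuation ring with finite residue field) with maximal ideal $\wp$, uniformizer $\pi$ and residue field of cardinality $q$ and characteristic $2$. Put $\mathbf R_{\mathfrak o}=4e$ if $\mathrm{Char}(\mathfrak o)=0$ and $2\mathfrak o=\wp^e$, and $\mathbf R_{\mathfrak o}=2$ if $\mathrm{Char}(\mathfrak o)=2$. Let $r\ge \mathbf R_{\mathfrak o}$, $\ell=\lceil r/2\rceil$, $\ell'=\lfloor r/2\rfloor$, and write $\mathfrak o_k=\mathfrak o/\wp^k$. Fix a homomorphism $\psi:(\mathfrak o_r,+)\to\mathbb C^\times$ with $\psi(\pi^{r-1})\ne 1$. Let $M^\ell$ and $K^\ell$ be the kernels of the reduction maps $\mathrm{GL}_2(\mathfrak o_r)\to\mathrm{GL}_2(\mathfrak o_\ell)$ and $\mathrm{SL}_2(\mathfrak o_r)\to\mathrm{SL}_2(\mathfrak o_\ell)$. Let $A\in M_2(\mathfrak o_{\ell'})$ be cyclic, i.e. $v,Av$ generate $\mathfrak o_{\ell'}^{2}$ for some vector $v$, and let $\tilde A\in M_2(\mathfrak o_r)$ be any lift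 of $A$. Let $\psi_{[A]}:K^\ell\to\mathbb C^\times$ be the homomorphism $I+\pi^\ell B\mapsto\psi(\pi^\ell\,\mathrm{tr}(\tilde A B))$ (it depends only on $A$), and put $C_S^\ell(\tilde A)=\big(C_{\mathrm{GL}_2(\mathfrak o_r)}(\tilde A)\,M^\ell\big)\cap\mathrm{SL}_2(\mathfrak o_r)$. If $\tilde A=\begin{pmatrix}0&\tilde a^{-1}\tilde\alpha\\ \tilde a&\tilde\beta\end{pmatrix}$ with $\tilde a\in\mathfrak o_r^\times$, put $$\mathrm H_{\tilde A}^\ell=\Big\{\begin{pmatrix}1&\tilde a^{-1}x\\0&1\end{pmatrix}\ :\ x\in\mathfrak o_r,\ 2x\equiv 0 \text{ and } x(x+\tilde\beta)\equiv0 \bmod \wp^\ell\Big\}.$$ In general $\tilde A$ is cyclic, hence $g\tilde Ag^{-1}$ has this form for some $g\in\mathrm{SL}_2(\mathfrak o_r)$, and we put $\mathrm H^\ell_{\tilde A}=g^{-1}\,\mathrm H^\ell_{g\tilde Ag^{-1}}\,g$ for any such $g$. For every homomorphism $\chi:C_S^\ell(\tilde A)\to\mathbb C^\times$ extending $\psi_{[A]}$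 let $H_{\tilde A}(\chi)=\{h\in C_S^\ell(\tilde A)\,\mathrm H_{\tilde A}^\ell : \chi^h=\chi\}$, where $\chi^h(x)=\chi(hxh^{-1})$. Then, for every cyclic $A$, every lift $\tilde A$, every such choice of $g$ and every such $\chi$, $$\frac{|H_{\tilde A}(\chi)|}{|C_S^\ell(\tilde A)|}\le q^3 .$$ -/

import Mathlib

namespace SLTwo

open IsLocalRing Matrix

section Rings

variable (𝔬 : Type*) [CommRing 𝔬] [IsLocalRing 𝔬]

/-- The finite quotient `𝔬_k = 𝔬 / ℘ ^ k`. -/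
abbrev Quo (k : ℕ) : Type _ := 𝔬 ⧸ (maximalIdeal 𝔬 ^ k)

/-- The natural surjection `𝔬_r → 𝔬_i` for `i ≤ r`. -/
def red {r i : ℕ} (h : i ≤ r) : Quo 𝔬 r →+* Quo 𝔬 i :=
  Ideal.Quotient.factorPow (maximalIdeal 𝔬) h

/-- The ramification index `e` of a ring `𝔬` of characteristic zero with residue characteristic
two, given by `2 𝔬 = ℘ ^ e`. -/
noncomputable def ramIndex : ℕ :=
  sInf {e : ℕ | Ideal.span {(2 : 𝔬)} = maximalIdeal 𝔬 ^ e}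

/-- The bound `R_𝔬`: it is `4 e` in characteristic zero, and `2` in characteristic two. -/
noncomputable def levelBound : ℕ :=
  if ringChar 𝔬 = 0 then 4 * ramIndex 𝔬 else 2

end Rings

/-- `ℓ = ⌈r / 2⌉`. -/
abbrev ell (r : ℕ) : ℕ := (r + 1) / 2

/-- `ℓ' = ⌊r / 2⌋`. -/
abbrev ell' (r : ℕ) : ℕ := r / 2

theorem ell_le (r : ℕ) : ell r ≤ r := by unfold ell; omega

theorem ell'_le (r : ℕ) : ell' r ≤ r := by unfold ell'; omega

/-- A `2 × 2` matrix `A` is cyclic if `v` and `A v` generate the free module `R ^ 2` for some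
vector `v`. -/
def IsCyclicMat {R : Type*} [CommRing R] (A : Matrix (Fin 2) (Fin 2) R) : Prop :=
  ∃ v : Fin 2 → R, Submodule.span R {v, A *ᵥ v} = ⊤

/-- The matrix with rows `(0, a⁻¹ α)` and `(a, β)`. -/
def companionForm {R : Type*} [CommRing R] (a : Rˣ) (α β : R) : Matrix (Fin 2) (Fin 2) R :=
  !![0, (↑a⁻¹ : R) * α; (a : R), β]

/-- A presentation of `A` as an `SL₂`-conjugate of a matrix `companionForm a α β`. -/
structure NormalForm {R : Type*} [CommRing R] (A : Matrix (Fin 2) (Fin 2) R) where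
  g : SpecialLinearGroup (Fin 2) R
  a : Rˣ
  α : R
  β : R
  conj_eq : (g : Matrix (Fin 2) (Fin 2) R) * A * ((g⁻¹ : SpecialLinearGroup (Fin 2) R) :
    Matrix (Fin 2) (Fin 2) R) = companionForm a α β

/-- The matrix with rows `(1, a⁻¹ x)` and `(0, 1)`, as an element of `SL₂`. -/
def unip {R : Type*} [CommRing R] (a : Rˣ) (x : R) : SpecialLinearGroup (Fin 2) R :=
  ⟨!![1, (↑a⁻¹ : R) * x; 0, 1], by simp⟩

section Groups

variable {𝔬 : Type*} [CommRing 𝔬] [IsLocalRing 𝔬]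

/-- `M ^ i`, the `i`-th congruence subgroup of `GL₂(𝔬_r)`. -/
def congGL {r i : ℕ} (h : i ≤ r) : Subgroup (GL (Fin 2) (Quo 𝔬 r)) :=
  (GeneralLinearGroup.map (n := Fin 2) (red 𝔬 h)).ker

/-- `K ^ i`, the `i`-th congruence subgroup of `SL₂(𝔬_r)`. -/
def congSL {r i : ℕ} (h : i ≤ r) : Subgroup (SpecialLinearGroup (Fin 2) (Quo 𝔬 r)) :=
  (SpecialLinearGroup.map (n := Fin 2) (red 𝔬 h)).ker

/-- The centralizer of the matrix `A` in `GL₂(R)`. -/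
def centGL {R : Type*} [CommRing R] (A : Matrix (Fin 2) (Fin 2) R) :
    Subgroup (GL (Fin 2) R) where
  carrier := {g | (g : Matrix (Fin 2) (Fin 2) R) * A = A * (g : Matrix (Fin 2) (Fin 2) R)}
  one_mem' := by simp
  mul_mem' := by
    intro g h hg hh
    simp only [Set.mem_ofPred_eq, Units.val_mul] at *
    rw [mul_assoc, hh, ← mul_assoc, hg, mul_assoc]
  inv_mem' := by
    intro g hg
    simp only [Set.mem_ofPred_eq] at *
    rw [Units.inv_mul_eq_iff_eq_mul, ← mul_assoc, hg, mul_assoc, Units.mul_inv, mul_one]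

/-- `C_G^ℓ(Ã) = C_{GL₂(𝔬_r)}(Ã) M ^ ℓ`; since `M ^ ℓ` is normal, the join is the product. -/
def cG {r : ℕ} (At : Matrix (Fin 2) (Fin 2) (Quo 𝔬 r)) : Subgroup (GL (Fin 2) (Quo 𝔬 r)) :=
  centGL At ⊔ congGL (ell_le r)

/-- `C_S^ℓ(Ã) = C_G^ℓ(Ã) ∩ SL₂(𝔬_r)`. -/
def cS {r : ℕ} (At : Matrix (Fin 2) (Fin 2) (Quo 𝔬 r)) :
    Subgroup (SpecialLinearGroup (Fin 2) (Quo 𝔬 r)) :=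
  (cG At).comap SpecialLinearGroup.toGL

theorem congSL_le_cS {r : ℕ} (At : Matrix (Fin 2) (Fin 2) (Quo 𝔬 r)) :
    congSL (ell_le r) ≤ cS At := by
  intro k hk
  refine Subgroup.mem_sup_right (?_ : SpecialLinearGroup.toGL k ∈ congGL (ell_le r))
  have hk' : SpecialLinearGroup.map (n := Fin 2) (red 𝔬 (ell_le r)) k = 1 := hk
  change GeneralLinearGroup.map (n := Fin 2) (red 𝔬 (ell_le r)) (SpecialLinearGroup.toGL k) = 1
  ext i j
  have := congrArg (fun m : SpecialLinearGroup (Fin 2) (Quo 𝔬 (ell r)) => m i j) hk'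
  simpa using this

/-- The additive group `h_Ã^ℓ`, which depends on `β̃` only: all `x` in `𝔬_r` with
`2 x = 0` and `x (x + β̃) = 0` modulo `℘ ^ ℓ`. -/
def hAdd {r : ℕ} (β : Quo 𝔬 r) : Set (Quo 𝔬 r) :=
  {x | red 𝔬 (ell_le r) (2 * x) = 0 ∧ red 𝔬 (ell_le r) (x * (x + β)) = 0}

/-- `H_Ã^ℓ`: for `Ã = companionForm a α β` (so `N.g = 1`), the matrices `unip a x` with `x` in
`h_Ã^ℓ`; for an `SL₂`-conjugate of such a matrix, the corresponding conjugate. -/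
def hGrp {r : ℕ} {At : Matrix (Fin 2) (Fin 2) (Quo 𝔬 r)} (N : NormalForm At) :
    Set (SpecialLinearGroup (Fin 2) (Quo 𝔬 r)) :=
  {h | ∃ x ∈ hAdd N.β, h = N.g⁻¹ * unip N.a x * N.g}

/-- The stabilizer `H_Ã(χ)` of a one-dimensional representation `χ` of `C_S^ℓ(Ã)`: all `g` in the
product `C_S^ℓ(Ã) H_Ã^ℓ` with `χ ^ g = χ`. -/
def stab {r : ℕ} {At : Matrix (Fin 2) (Fin 2) (Quo 𝔬 r)} (N : NormalForm At)
    (χ : cS At →* ℂˣ) : Set (SpecialLinearGroup (Fin 2) (Quo 𝔬 r)) :=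
  {g | (∃ c ∈ cS At, ∃ h ∈ hGrp N, g = c * h) ∧
    ∀ x : cS At, ∃ hx : g * (x : SpecialLinearGroup (Fin 2) (Quo 𝔬 r)) * g⁻¹ ∈ cS At,
      χ ⟨g * x * g⁻¹, hx⟩ = χ x}

end Groups

section Facts

variable {R : Type*} [CommRing R]

theorem isCyclicMat_iff (A : Matrix (Fin 2) (Fin 2) R) :
    IsCyclicMat A ↔ ∃ v : Fin 2 → R, IsUnit (v 0 * (A *ᵥ v) 1 - v 1 * (A *ᵥ v) 0) := by
  constructor
  · rintro ⟨v, hv⟩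
    refine ⟨v, ?_⟩
    have h0 : (![1, 0] : Fin 2 → R) ∈ Submodule.span R {v, A *ᵥ v} := hv ▸ Submodule.mem_top
    have h1 : (![0, 1] : Fin 2 → R) ∈ Submodule.span R {v, A *ᵥ v} := hv ▸ Submodule.mem_top
    obtain ⟨p, q, hpq⟩ := Submodule.mem_span_pair.1 h0
    obtain ⟨s, t, hst⟩ := Submodule.mem_span_pair.1 h1
    have e1 := congrFun hpq 0
    have e2 := congrFun hpq 1
    have e3 := congrFun hst 0
    have e4 := congrFun hst 1
    simp only [Pi.add_apply, Pi.smul_apply, smul_eq_mul, cons_val_zero, cons_val_one] at e1 e2 e3 e4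
    refine IsUnit.of_mul_eq_one (p * t - q * s) ?_
    linear_combination (s * v 1 + t * (A *ᵥ v) 1) * e1 + e4 - (p * v 1 + q * (A *ᵥ v) 1) * e3
  · rintro ⟨v, hv⟩
    refine ⟨v, ?_⟩
    obtain ⟨d, hd⟩ := hv.exists_right_inv
    rw [eq_top_iff]
    intro w _
    rw [Submodule.mem_span_pair]
    refine ⟨d * (w 0 * (A *ᵥ v) 1 - w 1 * (A *ᵥ v) 0), d * (v 0 * w 1 - v 1 * w 0), ?_⟩
    ext i
    fin_cases i
    · simp only [Fin.zero_eta, Pi.add_apply, Pi.smul_apply, smul_eq_mul]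
      linear_combination (w 0) * hd
    · simp only [Fin.mk_one, Pi.add_apply, Pi.smul_apply, smul_eq_mul]
      linear_combination (w 1) * hd

/-- Every cyclic matrix is `SL₂`-conjugate to some `companionForm a α β`. -/
theorem IsCyclicMat.nonempty_normalForm {A : Matrix (Fin 2) (Fin 2) R} (hA : IsCyclicMat A) :
    Nonempty (NormalForm A) := by
  obtain ⟨v, hv⟩ := (isCyclicMat_iff A).1 hA
  obtain ⟨a, ha⟩ := hv
  have haa : (a : R) * (↑a⁻¹ : R) = 1 := Units.mul_inv a
  have w0 : (A *ᵥ v) 0 = A 0 0 * v 0 + A 0 1 * v 1 := by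
    simp [mulVec, dotProduct, Fin.sum_univ_two]
  have w1 : (A *ᵥ v) 1 = A 1 0 * v 0 + A 1 1 * v 1 := by
    simp [mulVec, dotProduct, Fin.sum_univ_two]
  rw [w0, w1] at ha
  let P : SpecialLinearGroup (Fin 2) R :=
    ⟨!![v 0, (↑a⁻¹ : R) * (A 0 0 * v 0 + A 0 1 * v 1);
        v 1, (↑a⁻¹ : R) * (A 1 0 * v 0 + A 1 1 * v 1)], by
      rw [det_fin_two_of]
      linear_combination haa - (↑a⁻¹ : R) * ha⟩
  refine ⟨⟨P⁻¹, a, -A.det, A.trace, ?_⟩⟩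
  have key : A * (P : Matrix (Fin 2) (Fin 2) R) =
      (P : Matrix (Fin 2) (Fin 2) R) * companionForm a (-A.det) A.trace := by
    ext i j
    fin_cases i <;> fin_cases j <;>
      simp only [P, companionForm, mul_apply, Fin.sum_univ_two, det_fin_two, trace_fin_two,
        of_apply, cons_val', cons_val_zero, cons_val_one, Fin.zero_eta, Fin.mk_one,
        cons_val_fin_one]
    · linear_combination (-(A 0 0 * v 0 + A 0 1 * v 1)) * haa
    · ring
    · linear_combination (-(A 1 0 * v 0 + A 1 1 * v 1)) * haa
    · ring
  have hP : ((P⁻¹ : SpecialLinearGroup (Fin 2) R) : Matrix (Fin 2) (Fin 2) R) *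
      (P : Matrix (Fin 2) (Fin 2) R) = 1 := congrArg Subtype.val (inv_mul_cancel P)
  rw [inv_inv, mul_assoc, key, ← mul_assoc, hP, one_mul]

end Facts

section Characters

variable {𝔬 : Type*} [CommRing 𝔬] [IsLocalRing 𝔬]

theorem red_surjective {r i : ℕ} (h : i ≤ r) : Function.Surjective (red 𝔬 h) :=
  Ideal.Quotient.factor_surjective (Ideal.pow_le_pow_right h)

/-- Every lift of a cyclic matrix is cyclic. -/
theorem IsCyclicMat.of_lift {r i : ℕ} (h : i ≤ r) (hi : 1 ≤ i) {A : Matrix (Fin 2) (Fin 2) (Quo 𝔬 i)}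
    (hA : IsCyclicMat A) {At : Matrix (Fin 2) (Fin 2) (Quo 𝔬 r)} (hAt : At.map (red 𝔬 h) = A) :
    IsCyclicMat At := by
  obtain ⟨v, hv⟩ := (isCyclicMat_iff A).1 hA
  choose f hf using red_surjective (𝔬 := 𝔬) h
  refine (isCyclicMat_iff At).2 ⟨fun j => f (v j), ?_⟩
  have hle : maximalIdeal 𝔬 ^ i ≠ ⊤ := fun ht => (maximalIdeal.isMaximal 𝔬).ne_top
    (top_le_iff.1 (ht ▸ Ideal.pow_le_self (by omega)))
  have hler : maximalIdeal 𝔬 ^ r ≠ ⊤ := fun ht => hle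
    (top_le_iff.1 (ht ▸ Ideal.pow_le_pow_right h))
  have : Nontrivial (Quo 𝔬 i) := Ideal.Quotient.nontrivial_iff.2 hle
  have : Nontrivial (Quo 𝔬 r) := Ideal.Quotient.nontrivial_iff.2 hler
  have : IsLocalRing (Quo 𝔬 r) :=
    IsLocalRing.of_surjective' (Ideal.Quotient.mk _) Ideal.Quotient.mk_surjective
  have : IsLocalHom (red 𝔬 h) := (red_surjective h).isLocalHom
  refine isUnit_of_map_unit (red 𝔬 h) _ ?_
  convert hv using 1
  subst hAt
  simp [mulVec, dotProduct, Fin.sum_univ_two, hf]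

theorem red_eq_zero_iff {r i : ℕ} (h : i ≤ r) (x : 𝔬) :
    red 𝔬 h (Ideal.Quotient.mk _ x) = 0 ↔ x ∈ maximalIdeal 𝔬 ^ i := by
  change Ideal.Quotient.mk _ x = 0 ↔ _
  exact Ideal.Quotient.eq_zero_iff_mem

theorem mul_eq_zero_of_red {r i j : ℕ} (hi : i ≤ r) (hj : j ≤ r) (hij : r ≤ i + j)
    {x y : Quo 𝔬 r} (hx : red 𝔬 hi x = 0) (hy : red 𝔬 hj y = 0) : x * y = 0 := by
  obtain ⟨x, rfl⟩ := Ideal.Quotient.mk_surjective x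
  obtain ⟨y, rfl⟩ := Ideal.Quotient.mk_surjective y
  rw [red_eq_zero_iff] at hx hy
  rw [← map_mul, Ideal.Quotient.eq_zero_iff_mem]
  exact Ideal.pow_le_pow_right hij (pow_add (maximalIdeal 𝔬) i j ▸ Ideal.mul_mem_mul hx hy)

theorem matrix_mul_eq_zero {r i j : ℕ} (hi : i ≤ r) (hj : j ≤ r) (hij : r ≤ i + j)
    {X Y : Matrix (Fin 2) (Fin 2) (Quo 𝔬 r)} (hX : X.map (red 𝔬 hi) = 0)
    (hY : Y.map (red 𝔬 hj) = 0) : X * Y = 0 := by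
  ext s t
  rw [mul_apply, Matrix.zero_apply]
  refine Finset.sum_eq_zero fun k _ => mul_eq_zero_of_red hi hj hij ?_ ?_
  · exact congrFun (congrFun hX s) k
  · exact congrFun (congrFun hY k) t

theorem congSL_sub_one {r i : ℕ} (h : i ≤ r) {k : SpecialLinearGroup (Fin 2) (Quo 𝔬 r)}
    (hk : k ∈ congSL h) :
    ((k : Matrix (Fin 2) (Fin 2) (Quo 𝔬 r)) - 1).map (red 𝔬 h) = 0 := by
  have hk' : SpecialLinearGroup.map (n := Fin 2) (red 𝔬 h) k = 1 := hk
  have hm : (red 𝔬 h).mapMatrix (k : Matrix (Fin 2) (Fin 2) (Quo 𝔬 r)) = 1 :=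
    congrArg Subtype.val hk'
  change (red 𝔬 h).mapMatrix _ = 0
  rw [map_sub, hm, map_one, sub_self]

/-- The restriction to `K ^ ℓ` of the one-dimensional representation `ψ_Â` of `M ^ ℓ`, written
without the uniformizer: `X ↦ ψ (trace (Â (X - 1)))`. -/
def psiLift {r : ℕ} (ψ : AddChar (Quo 𝔬 r) ℂˣ) (Ah : Matrix (Fin 2) (Fin 2) (Quo 𝔬 r)) :
    (congSL (𝔬 := 𝔬) (ell_le r)) →* ℂˣ where
  toFun k := ψ (trace (Ah * ((k : SpecialLinearGroup (Fin 2) (Quo 𝔬 r)).1 - 1)))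
  map_one' := by simp
  map_mul' := by
    intro k m
    rw [← AddChar.map_add_eq_mul, ← trace_add, ← mul_add]
    congr 3
    have := matrix_mul_eq_zero (ell_le r) (ell_le r) (by unfold ell; omega)
      (congSL_sub_one _ k.2) (congSL_sub_one _ m.2)
    rw [sub_mul, mul_sub, mul_sub, one_mul, one_mul, mul_one] at this
    rw [← sub_eq_zero, ← this]
    change (k.1.1 * m.1.1) - 1 - _ = _
    abel

/-- The one-dimensional representation `ψ_[A]` of `K ^ ℓ` for `A` in `M₂(𝔬_ℓ')`, defined by means
of an arbitrary lift of `A`; see `psi_apply`. -/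
noncomputable def psi {r : ℕ} (ψ : AddChar (Quo 𝔬 r) ℂˣ)
    (A : Matrix (Fin 2) (Fin 2) (Quo 𝔬 (ell' r))) :
    (congSL (𝔬 := 𝔬) (ell_le r)) →* ℂˣ :=
  psiLift ψ (A.map (Function.surjInv (red_surjective (ell'_le r))))

theorem psi_eq_psiLift {r : ℕ} (ψ : AddChar (Quo 𝔬 r) ℂˣ)
    (A : Matrix (Fin 2) (Fin 2) (Quo 𝔬 (ell' r))) (Ah : Matrix (Fin 2) (Fin 2) (Quo 𝔬 r))
    (hA : Ah.map (red 𝔬 (ell'_le r)) = A) : psi ψ A = psiLift ψ Ah := by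
  ext1 k
  change ψ _ = ψ _
  congr 2
  rw [← sub_eq_zero, ← sub_mul]
  refine matrix_mul_eq_zero (ell'_le r) (ell_le r) (by unfold ell ell'; omega) ?_
    (congSL_sub_one _ k.2)
  subst hA
  ext i j
  simp [Function.surjInv_eq]

/-- The defining formula `ψ_[A] (I + π ^ ℓ B) = ψ (π ^ ℓ trace (Â B))`, for every lift `Â`. -/
theorem psi_apply {r : ℕ} (ψ : AddChar (Quo 𝔬 r) ℂˣ)
    (A : Matrix (Fin 2) (Fin 2) (Quo 𝔬 (ell' r))) (Ah : Matrix (Fin 2) (Fin 2) (Quo 𝔬 r))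
    (hA : Ah.map (red 𝔬 (ell'_le r)) = A) (ϖ : 𝔬) (B : Matrix (Fin 2) (Fin 2) (Quo 𝔬 r))
    (k : congSL (𝔬 := 𝔬) (ell_le r))
    (hk : (k : SpecialLinearGroup (Fin 2) (Quo 𝔬 r)).1 =
      1 + (Ideal.Quotient.mk _ (ϖ ^ ell r) : Quo 𝔬 r) • B) :
    psi ψ A k = ψ ((Ideal.Quotient.mk _ (ϖ ^ ell r) : Quo 𝔬 r) * trace (Ah * B)) := by
  rw [psi_eq_psiLift ψ A Ah hA]
  change ψ _ = ψ _
  rw [hk, add_sub_cancel_left, Matrix.mul_smul, trace_smul, smul_eq_mul]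

/-- The set `𝓔_Ã` of all extensions of `ψ_[A]` to `C_S^ℓ(Ã)`. -/
def extensions {r : ℕ} (ψ : AddChar (Quo 𝔬 r) ℂˣ)
    (A : Matrix (Fin 2) (Fin 2) (Quo 𝔬 (ell' r)))
    (At : Matrix (Fin 2) (Fin 2) (Quo 𝔬 r)) : Set (cS At →* ℂˣ) :=
  {χ | ∀ k : congSL (𝔬 := 𝔬) (ell_le r),
    χ (Subgroup.inclusion (congSL_le_cS At) k) = psi ψ A k}

end Characters

end SLTwo

/-!
Conjugating by `g`, the group `H_Ã^ℓ` consists of elements `1 + x E` with `E` nilpotent and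
`tr (Ã E) = 1`, so the stabilizer of `χ` is `C_S^ℓ(Ã)` times the elements `1 + x E` that fix `χ`,
and the ratio is the index of `℘ ^ ℓ` in the group `T` of the corresponding `x`. If `1 + x E` fixes
`χ`, then `χ` is trivial on its commutators with `C_S^ℓ(Ã)`. The commutator with an element
congruent to `s + t Ã` lies in `K^ℓ` as soon as `t x ∈ ℘ ^ ℓ`, where `χ` is given by a trace, and
the condition becomes `ψ (x (N(s, t) - 1) - s t x ^ 2) = 1` for the norm form
`N(s, t) = s ^ 2 + τ s t + Δ t ^ 2`.

Each valuation below `ℓ` that occurs in `T` contributes a factor of at most `q` to the index. If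
`2` has valuation `e` and `4 e ≤ r`, taking `t = 0` leaves only the valuation `ℓ - 1`. If `2 = 0`,
squaring is onto modulo `π`, so `Δ = γ ^ 2 + π δ ^ 2`, and the substitution `s = 1 + γ t` cancels
`γ`. Letting `t` vary shows that a valuation `m` occurring in `T` is `ℓ - 1`, or `v(τ)`, or the
unique solution of `m + 2 min(m, v(τ)) = r + 2 v(δ)`, so there are at most three.
-/

namespace SLTwo

open IsLocalRing Matrix Finset
open scoped commutatorElement

section Trace

variable {R : Type*} [CommRing R] {A E : Matrix (Fin 2) (Fin 2) R}

/-- The norm `det (s + t A)`, written in terms of the trace `τ` and the determinant `Δ` of `A`. -/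
def normForm (τ Δ s t : R) : R := s ^ 2 + τ * s * t + Δ * t ^ 2

theorem det_smul_one_add_smul (A : Matrix (Fin 2) (Fin 2) R) (s t : R) :
    (s • 1 + t • A).det = normForm A.trace A.det s t := by
  simp only [det_fin_two, trace_fin_two, normForm, Matrix.add_apply, Matrix.smul_apply,
    one_fin_two, of_apply, cons_val', cons_val_zero, cons_val_one, cons_val_fin_one, smul_eq_mul]
  ring

theorem mul_self_eq_trace_smul_sub_det_smul_one (A : Matrix (Fin 2) (Fin 2) R) :
    A * A = A.trace • A - A.det • 1 := by
  nontriviality R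
  have cayley_hamilton := A.aeval_self_charpoly
  rw [charpoly_fin_two] at cayley_hamilton
  simp only [map_add, map_sub, map_mul, Polynomial.aeval_X, Polynomial.aeval_C,
    Algebra.algebraMap_eq_smul_one, smul_one_mul, sq] at cayley_hamilton
  linear_combination (norm := module) cayley_hamilton

theorem adjugate_smul_one_add_smul (A : Matrix (Fin 2) (Fin 2) R) (s t : R) :
    (s • 1 + t • A).adjugate = (s + t * A.trace) • 1 - t • A := by
  ext i j
  fin_cases i <;> fin_cases j <;> simp [adjugate_fin_two, trace_fin_two] <;> ring

theorem mul_mul_self_of_det_eq_zero (hdet : E.det = 0) (A : Matrix (Fin 2) (Fin 2) R) :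
    E * A * E = trace (A * E) • E := by
  rw [det_fin_two] at hdet
  ext i j
  fin_cases i <;> fin_cases j <;>
    simp only [Fin.zero_eta, Fin.mk_one, mul_apply, Fin.sum_univ_two, trace_fin_two,
      Matrix.smul_apply, smul_eq_mul]
  · linear_combination (-A 1 1) * hdet
  · linear_combination A 0 1 * hdet
  · linear_combination A 1 0 * hdet
  · linear_combination (-A 0 0) * hdet

theorem commute_smul_one_add_smul (A : Matrix (Fin 2) (Fin 2) R) (s t : R) :
    Commute A (s • 1 + t • A) :=
  ((Commute.one_right A).smul_right s).add_right ((Commute.refl A).smul_right t)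

theorem mul_self_eq_zero_of_trace_of_det (htr : E.trace = 0) (hdet : E.det = 0) : E * E = 0 := by
  rw [mul_self_eq_trace_smul_sub_det_smul_one, htr, hdet, zero_smul, zero_smul, sub_zero]

theorem det_one_add_smul_mul (hdet : E.det = 0) (hAE : trace (A * E) = 1) (c : R) :
    (1 + c • (E * A)).det = 1 + c := by
  rw [← one_smul R (1 : Matrix (Fin 2) (Fin 2) R), det_smul_one_add_smul, normForm, det_mul, hdet,
    trace_mul_comm, hAE]
  ring

theorem trace_mul_lie_mul_of_commute {Z : Matrix (Fin 2) (Fin 2) R} (hZ : Commute A Z) :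
    trace (A * ((E * A - A * E) * Z)) = 0 := by
  have h : trace (A * (E * A * Z)) = trace (A * (A * E * Z)) :=
    calc trace (A * (E * A * Z)) = trace (A * (E * Z) * A) := by
          rw [mul_assoc E, hZ.eq, ← mul_assoc E, ← mul_assoc A]
      _ = trace (A * (A * E * Z)) := by rw [trace_mul_comm, mul_assoc A E]
  rw [sub_mul, mul_sub, trace_sub, h, sub_self]

theorem trace_mul_lie_mul_mul_adjugate (htr : E.trace = 0) (hdet : E.det = 0)
    (hAE : trace (A * E) = 1) (s t : R) :
    trace (A * ((E * A - A * E) * E * (s • 1 + t • A).adjugate)) = s := by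
  have hE := mul_self_eq_zero_of_trace_of_det htr hdet
  have hEAE : E * A * E = E := by rw [mul_mul_self_of_det_eq_zero hdet, hAE, one_smul]
  have hAEA : trace (A * E * A) = A.trace := by
    rw [trace_mul_comm, ← mul_assoc, mul_self_eq_trace_smul_sub_det_smul_one, sub_mul,
      smul_mul_assoc, smul_mul_assoc, one_mul, trace_sub, trace_smul, trace_smul, hAE, htr]
    simp
  rw [sub_mul, hEAE, mul_assoc A E E, hE, mul_zero, sub_zero, adjugate_smul_one_add_smul, mul_sub,
    mul_sub, mul_smul_comm, mul_smul_comm, mul_smul_comm, mul_smul_comm, mul_one, ← mul_assoc,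
    trace_sub, trace_smul, trace_smul, hAE, hAEA, smul_eq_mul, smul_eq_mul, mul_one,
    add_sub_cancel_right]

theorem trace_mul_mul_mul_adjugate_of_commute {Y : Matrix (Fin 2) (Fin 2) R} (hY : Commute A Y) :
    trace (A * (Y * E * Y.adjugate)) = Y.det * trace (A * E) := by
  rw [← mul_assoc, ← mul_assoc, hY.eq, trace_mul_comm, mul_assoc Y, ← mul_assoc, adjugate_mul,
    smul_mul_assoc, one_mul, trace_smul, smul_eq_mul]

theorem coe_commutator_sub_one (u X : SpecialLinearGroup (Fin 2) R) :
    (⁅u, X⁆.1 : Matrix (Fin 2) (Fin 2) R) - 1 =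
      (u.1 * X.1 - X.1 * u.1) * (u.1.adjugate * X.1.adjugate) := by
  have h : (X * u * u⁻¹ * X⁻¹).1 = 1 := by simp
  have h' : (X * u * u⁻¹ * X⁻¹).1 = X.1 * u.1 * (u.1.adjugate * X.1.adjugate) := mul_assoc _ _ _
  rw [sub_mul, ← h', h, commutatorElement_def]
  exact congrArg (· - 1) (mul_assoc _ _ _)

theorem adjugate_one_add_smul (A : Matrix (Fin 2) (Fin 2) R) (t : R) :
    (1 + t • A).adjugate = (1 + t * A.trace) • 1 - t • A := by
  simpa only [one_smul] using adjugate_smul_one_add_smul A 1 t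

theorem mul_sub_mul_of_mul_mul_self (hE : E * E = 0) (hEAE : E * A * E = E) {x s t c : R}
    (hxtc : x * t * c = 0) :
    (1 + x • E) * ((s • 1 + t • A) * (1 + c • (E * A))) -
        (s • 1 + t • A) * (1 + c • (E * A)) * (1 + x • E) =
      (x * t) • (E * A - A * E) - (x * c) • ((s • 1 + t • A) * E) := by
  have hAEAE : A * E * A * E = A * E := by rw [mul_assoc, mul_assoc, ← mul_assoc E, hEAE]
  simp only [mul_add, add_mul, smul_mul_assoc, mul_smul_comm, mul_one, one_mul, ← mul_assoc, hE,
    hEAE, hAEAE, zero_mul, smul_zero]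
  linear_combination (norm := module) hxtc • (E * A)

theorem mul_one_sub_smul_mul_of_mul_self_eq_zero (hE : E * E = 0) (L Y : Matrix (Fin 2) (Fin 2) R)
    {x t c : R} (hxtc : x * t * c = 0) (hcc : c * c = 0) :
    ((x * t) • L - (x * c) • (Y * E)) * ((1 - x • E) * ((1 + c) • 1 - c • (E * A))) =
      (x * t) • L - (x ^ 2 * t) • (L * E) - (x * c) • (Y * E) := by
  have hEE (Z : Matrix (Fin 2) (Fin 2) R) : Z * E * E = 0 := by rw [mul_assoc, hE, mul_zero]
  simp only [mul_sub, sub_mul, smul_mul_assoc, mul_smul_comm, mul_one, one_mul, ← mul_assoc, hEE,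
    zero_mul, smul_zero, sub_zero]
  linear_combination (norm := module) hxtc • (L - x • (L * E) - L * E * A) - hcc • x • (Y * E)

theorem coe_commutator_sub_one_eq (htr : E.trace = 0) (hdet : E.det = 0)
    (hAE : trace (A * E) = 1) {x s t c : R} (hxtc : x * t * c = 0) (hcc : c * c = 0)
    {u X : SpecialLinearGroup (Fin 2) R} (hu : u.1 = 1 + x • E)
    (hX : X.1 = (s • 1 + t • A) * (1 + c • (E * A))) :
    ⁅u, X⁆.1 - 1 = ((x * t) • (E * A - A * E) - (x ^ 2 * t) • ((E * A - A * E) * E)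
      - (x * c) • ((s • 1 + t • A) * E)) * (s • 1 + t • A).adjugate := by
  have hE := mul_self_eq_zero_of_trace_of_det htr hdet
  have hEAE : E * A * E = E := by rw [mul_mul_self_of_det_eq_zero hdet, hAE, one_smul]
  rw [coe_commutator_sub_one, hu, hX, mul_sub_mul_of_mul_mul_self hE hEAE hxtc,
    adjugate_mul_distrib, adjugate_one_add_smul, adjugate_one_add_smul, htr, trace_mul_comm E, hAE,
    mul_zero, add_zero, one_smul, mul_one, ← mul_assoc (1 - x • E), ← mul_assoc,
    mul_one_sub_smul_mul_of_mul_self_eq_zero hE _ _ hxtc hcc]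

theorem trace_mul_commutator_sub_one (htr : E.trace = 0) (hdet : E.det = 0)
    (hAE : trace (A * E) = 1) {x s t c : R} (hxtc : x * t * c = 0) (hcc : c * c = 0)
    {u X : SpecialLinearGroup (Fin 2) R} (hu : u.1 = 1 + x • E)
    (hX : X.1 = (s • 1 + t • A) * (1 + c • (E * A))) :
    trace (A * (⁅u, X⁆.1 - 1)) =
      -(x * c * normForm A.trace A.det s t) - s * t * x ^ 2 := by
  have hAY := commute_smul_one_add_smul A s t
  have hAY' : Commute A (s • 1 + t • A).adjugate := by
    rw [adjugate_smul_one_add_smul]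
    exact ((Commute.one_right A).smul_right _).sub_right ((Commute.refl A).smul_right t)
  rw [coe_commutator_sub_one_eq htr hdet hAE hxtc hcc hu hX, sub_mul, sub_mul, mul_sub A, mul_sub A]
  simp only [smul_mul_assoc, mul_smul_comm, trace_sub, trace_smul]
  rw [trace_mul_lie_mul_of_commute hAY', trace_mul_lie_mul_mul_adjugate htr hdet hAE,
    trace_mul_mul_mul_adjugate_of_commute hAY, det_smul_one_add_smul, hAE]
  simp only [smul_eq_mul]
  ring

end Trace

section CharacterStabilizer

variable {G M : Type*} [Group G] [CommGroup M] {H : Subgroup G}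

/-- The subgroup of all `g` that normalize `H` and fix the homomorphism `χ : H →* M` under
conjugation. -/
def homStabilizer (χ : H →* M) : Subgroup G where
  carrier := {g | g ∈ Subgroup.normalizer (H : Set G) ∧
    ∀ (x : H) (hx : g * x * g⁻¹ ∈ H), χ ⟨g * x * g⁻¹, hx⟩ = χ x}
  one_mem' := ⟨one_mem _, fun x _ => by simp⟩
  mul_mem' := by
    rintro g h ⟨hgH, hg⟩ ⟨hhH, hh⟩
    refine ⟨mul_mem hgH hhH, fun x hx => ?_⟩
    have hhx : h * x * h⁻¹ ∈ H := (Subgroup.mem_normalizer_iff.1 hhH _).1 x.2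
    have e : g * h * x * (g * h)⁻¹ = g * (h * x * h⁻¹) * g⁻¹ := by group
    simp only [e] at hx ⊢
    rw [hg ⟨_, hhx⟩, hh]
  inv_mem' := by
    rintro g ⟨hgH, hg⟩
    refine ⟨inv_mem hgH, fun x hx => ?_⟩
    have e : g * (g⁻¹ * x * g⁻¹⁻¹) * g⁻¹ = x := by group
    have := hg ⟨_, hx⟩
    simp only [e, Subtype.coe_eta] at this
    exact (this x.2).symm

theorem mem_homStabilizer_of_forall [Finite H] {χ : H →* M} {g : G}
    (hg : ∀ x : H, ∃ hx : g * x * g⁻¹ ∈ H, χ ⟨g * x * g⁻¹, hx⟩ = χ x) : g ∈ homStabilizer χ :=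
  ⟨Subgroup.mem_normalizer_fintype fun x hx => (hg ⟨x, hx⟩).1, fun x _ => (hg x).2⟩

theorem le_homStabilizer (χ : H →* M) : H ≤ homStabilizer χ := by
  refine fun g hg => ⟨Subgroup.le_normalizer hg, fun x _ => ?_⟩
  calc χ ⟨g * x * g⁻¹, _⟩ = χ (⟨g, hg⟩ * x * ⟨g, hg⟩⁻¹) := rfl
    _ = χ x := by rw [map_mul, map_mul, map_inv, mul_right_comm, mul_inv_cancel, one_mul]

theorem map_commutator_eq_one {χ : H →* M} {g : G} (hg : g ∈ homStabilizer χ) (x : H)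
    (h : ⁅g, (x : G)⁆ ∈ H) : χ ⟨⁅g, (x : G)⁆, h⟩ = 1 := by
  have hx := (Subgroup.mem_normalizer_iff.1 hg.1 _).1 x.2
  have e : (⟨⁅g, (x : G)⁆, h⟩ : H) = ⟨_, hx⟩ * x⁻¹ := rfl
  rw [e, map_mul, hg.2 x hx, map_inv, mul_inv_cancel]

end CharacterStabilizer

section Counting

theorem card_le_card_mul_relIndex {G A : Type*} [Group G] [Finite G] [AddCommGroup A] [Finite A]
    {H : Subgroup G} {u : Multiplicative A →* G} {I T : AddSubgroup A} {S : Set G}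
    (hI : ∀ x ∈ I, u (.ofAdd x) ∈ H) (hS : ∀ g ∈ S, ∃ c ∈ H, ∃ x ∈ T, g = c * u (.ofAdd x)) :
    Nat.card S ≤ Nat.card H * I.relIndex T := by
  let f (z : H × T ⧸ I.addSubgroupOf T) : G := z.1 * u (.ofAdd (z.2.out : A))
  have hf : S ⊆ Set.range f := by
    intro g hg
    obtain ⟨c, hc, x, hx, rfl⟩ := hS g hg
    let y : T ⧸ I.addSubgroupOf T := QuotientAddGroup.mk ⟨x, hx⟩
    have hxy : x - (y.out : T) ∈ I := by
      have := QuotientAddGroup.eq.1 (QuotientAddGroup.out_eq' y)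
      rw [AddSubgroup.mem_addSubgroupOf] at this
      rwa [← neg_add_eq_sub]
    refine ⟨(⟨c, hc⟩ * ⟨_, hI _ hxy⟩, y), ?_⟩
    change c * u (.ofAdd (x - (y.out : T))) * u (.ofAdd (y.out : A)) = c * u (.ofAdd x)
    rw [mul_assoc, ← map_mul, ← ofAdd_add, sub_add_cancel]
  calc Nat.card S ≤ Nat.card (Set.range f) := Nat.card_mono (Set.toFinite _) hf
    _ ≤ Nat.card (H × T ⧸ I.addSubgroupOf T) := Finite.card_range_le f
    _ = Nat.card H * I.relIndex T := Nat.card_prod _ _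

open Classical in
theorem relIndex_le_pow_card_jumps {A : Type*} [AddCommGroup A] [Finite A] {q : ℕ}
    {F : ℕ → AddSubgroup A} (hF : Antitone F) (hq : ∀ i, (F (i + 1)).relIndex (F i) ≤ q)
    {T : AddSubgroup A} (hT : T ≤ F 0) (l : ℕ) :
    (F l).relIndex T ≤ q ^ #{i ∈ Finset.range l | ¬T ⊓ F i ≤ F (i + 1)} := by
  induction l with
  | zero => simp [AddSubgroup.relIndex_eq_one.2 hT]
  | succ l ih =>
    have hstep : (F (l + 1)).relIndex T = (F (l + 1)).relIndex (F l ⊓ T) * (F l).relIndex T := by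
      rw [AddSubgroup.relIndex_inf_mul_relIndex, inf_eq_left.2 (hF l.le_succ)]
    rw [hstep, Finset.range_add_one, Finset.filter_insert, inf_comm (F l)]
    split_ifs with hl
    · rwa [AddSubgroup.relIndex_eq_one.2 hl, one_mul]
    · have hjump : (F (l + 1)).relIndex (T ⊓ F l) ≤ q :=
        (AddSubgroup.relIndex_le_of_le_right inf_le_right
          AddSubgroup.FiniteIndex.index_ne_zero).trans (hq l)
      rw [Finset.card_insert_of_notMem (by simp), pow_succ']
      exact Nat.mul_le_mul hjump ih

theorem toAddSubgroup_span_mul {R : Type*} [CommRing R] (a b : R) :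
    (Ideal.span {a * b}).toAddSubgroup =
      (Ideal.span {b}).toAddSubgroup.map (AddMonoidHom.mulLeft a) := by
  ext x
  simp only [AddSubgroup.mem_map, Submodule.mem_toAddSubgroup, Ideal.mem_span_singleton]
  constructor
  · rintro ⟨c, rfl⟩
    exact ⟨b * c, ⟨c, rfl⟩, (mul_assoc a b c).symm⟩
  · rintro ⟨_, ⟨c, rfl⟩, rfl⟩
    exact ⟨c, (mul_assoc a b c).symm⟩

theorem relIndex_span_pow_le {R : Type*} [CommRing R] [Finite R] (p : R) (i : ℕ) :
    (Ideal.span {p ^ (i + 1)}).toAddSubgroup.relIndex (Ideal.span {p ^ i}).toAddSubgroup ≤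
      (Ideal.span {p}).toAddSubgroup.index := by
  have hi := toAddSubgroup_span_mul (p ^ i) 1
  rw [mul_one, Ideal.span_singleton_one, Submodule.top_toAddSubgroup] at hi
  rw [pow_succ, toAddSubgroup_span_mul, hi, AddSubgroup.relIndex_map_map, top_sup_eq,
    AddSubgroup.relIndex_top_right]
  exact Nat.le_of_dvd (Nat.pos_of_ne_zero AddSubgroup.FiniteIndex.index_ne_zero)
    (AddSubgroup.index_dvd_of_le le_sup_left)

theorem relIndex_span_pow_le_pow_card {R : Type*} [CommRing R] [Finite R] {p : R}
    (hp : ∀ y : R, ∃ u n, IsUnit u ∧ y = u * p ^ n) {T : AddSubgroup R} {l : ℕ} {V : Finset ℕ}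
    (hV : ∀ m < l, ∀ u, IsUnit u → u * p ^ m ∈ T → m ∈ V) :
    (Ideal.span {p ^ l}).toAddSubgroup.relIndex T ≤ (Ideal.span {p}).toAddSubgroup.index ^ #V := by
  classical
  have hanti : Antitone fun i => (Ideal.span {p ^ i}).toAddSubgroup := fun i j hij =>
    Ideal.span_singleton_le_span_singleton.2 (pow_dvd_pow p hij)
  refine (relIndex_le_pow_card_jumps hanti (relIndex_span_pow_le p) (by simp) l).trans
    (Nat.pow_le_pow_right (Nat.pos_of_ne_zero AddSubgroup.FiniteIndex.index_ne_zero)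
      (card_le_card fun m hm => ?_))
  obtain ⟨hml, hjump⟩ := mem_filter.1 hm
  obtain ⟨x, ⟨hxT, hx⟩, hx'⟩ := Set.not_subset.1 hjump
  obtain ⟨c, rfl⟩ := Ideal.mem_span_singleton'.1 hx
  obtain ⟨u, n, hu, rfl⟩ := hp c
  rcases n with _ | n
  · exact hV m (mem_range.1 hml) u hu (by simpa using hxT)
  · exact absurd (Ideal.mem_span_singleton.2 ⟨u * p ^ n, by ring⟩) hx'

end Counting

section NormalForm

variable {R : Type*} [CommRing R] {A : Matrix (Fin 2) (Fin 2) R}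

/-- The conjugate `g⁻¹ E g` of `E = !![0, a⁻¹; 0, 0]`, so that the conjugate of `unip a x`
is `1 + x g⁻¹ E g`. -/
def NormalForm.nilpotent (N : NormalForm A) : Matrix (Fin 2) (Fin 2) R :=
  N.g⁻¹.1 * !![0, (↑N.a⁻¹ : R); 0, 0] * N.g.1

theorem NormalForm.inv_mul_g (N : NormalForm A) : N.g⁻¹.1 * N.g.1 = 1 :=
  congrArg Subtype.val (inv_mul_cancel N.g)

theorem NormalForm.g_mul_inv (N : NormalForm A) : N.g.1 * N.g⁻¹.1 = 1 :=
  congrArg Subtype.val (mul_inv_cancel N.g)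

theorem NormalForm.trace_nilpotent (N : NormalForm A) : N.nilpotent.trace = 0 := by
  rw [nilpotent, mul_assoc, trace_mul_comm, mul_assoc, N.g_mul_inv, mul_one]
  simp [trace_fin_two]

theorem NormalForm.det_nilpotent (N : NormalForm A) : N.nilpotent.det = 0 := by
  simp [nilpotent]

theorem NormalForm.trace_mul_nilpotent (N : NormalForm A) : trace (A * N.nilpotent) = 1 := by
  have h : trace (A * N.nilpotent) =
      trace (companionForm N.a N.α N.β * !![0, (↑N.a⁻¹ : R); 0, 0]) := by
    rw [nilpotent, ← mul_assoc, trace_mul_comm, ← N.conj_eq]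
    simp only [mul_assoc]
  simp [h, companionForm, trace_fin_two]

theorem unip_add (a : Rˣ) (x y : R) : unip a (x + y) = unip a x * unip a y := by
  refine Subtype.ext ?_
  change !![1, (↑a⁻¹ : R) * (x + y); 0, 1] =
    !![1, (↑a⁻¹ : R) * x; 0, 1] * !![1, (↑a⁻¹ : R) * y; 0, 1]
  simp [mul_add, add_comm]

/-- The homomorphism `x ↦ g⁻¹ (unip a x) g`, whose restriction to `hAdd N.β` has image `hGrp N`. -/
def NormalForm.unipHom (N : NormalForm A) :
    Multiplicative R →* SpecialLinearGroup (Fin 2) R :=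
  MonoidHom.mk' (fun x => N.g⁻¹ * unip N.a x.toAdd * N.g) fun x y => by
    rw [toAdd_mul, unip_add]
    group

theorem NormalForm.unipHom_coe (N : NormalForm A) (x : R) :
    (N.unipHom (.ofAdd x)).1 = 1 + x • N.nilpotent := by
  have h : (unip N.a x).1 = 1 + x • !![0, (↑N.a⁻¹ : R); 0, 0] := by
    ext i j
    fin_cases i <;> fin_cases j <;> simp [unip, mul_comm]
  change N.g⁻¹.1 * (unip N.a x).1 * N.g.1 = _
  rw [h, mul_add, add_mul, mul_one, N.inv_mul_g, mul_smul_comm, smul_mul_assoc, nilpotent]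

end NormalForm

section Quotients

variable {𝔬 : Type*} [CommRing 𝔬] [IsLocalRing 𝔬] {r : ℕ}
    {At : Matrix (Fin 2) (Fin 2) (Quo 𝔬 r)}

theorem mem_congSL_iff {i : ℕ} (h : i ≤ r) {k : SpecialLinearGroup (Fin 2) (Quo 𝔬 r)} :
    k ∈ congSL h ↔ (k.1 - 1).map (red 𝔬 h) = 0 := by
  refine ⟨congSL_sub_one h, fun hk => Subtype.ext ?_⟩
  change (red 𝔬 h).mapMatrix k.1 = 1
  rwa [← sub_eq_zero, ← map_one (red 𝔬 h).mapMatrix, ← map_sub]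

theorem NormalForm.unipHom_mem_cS (N : NormalForm At) {x : Quo 𝔬 r}
    (hx : red 𝔬 (ell_le r) x = 0) : N.unipHom (.ofAdd x) ∈ cS At := by
  refine congSL_le_cS At ((mem_congSL_iff _).2 ?_)
  rw [N.unipHom_coe, add_sub_cancel_left]
  ext i j
  simp [hx]

theorem mem_cS_of_coe_eq_mul {g : SpecialLinearGroup (Fin 2) (Quo 𝔬 r)}
    {Y D : Matrix (Fin 2) (Fin 2) (Quo 𝔬 r)} (hg : g.1 = Y * D) (hY : Commute At Y)
    (hD : (D - 1).map (red 𝔬 (ell_le r)) = 0) : g ∈ cS At := by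
  have hdet : Y.det * D.det = 1 := by rw [← det_mul, ← hg, g.2]
  let Y' : GL (Fin 2) (Quo 𝔬 r) := GeneralLinearGroup.mk'' Y (.of_mul_eq_one _ hdet)
  let D' : GL (Fin 2) (Quo 𝔬 r) := GeneralLinearGroup.mk'' D (.of_mul_eq_one_right _ hdet)
  have hgl : SpecialLinearGroup.toGL g = Y' * D' := Units.ext hg
  have hD' : D' ∈ congGL (𝔬 := 𝔬) (ell_le r) := by
    refine Units.ext ?_
    change (red 𝔬 (ell_le r)).mapMatrix D = 1
    rwa [← sub_eq_zero, ← map_one (red 𝔬 (ell_le r)).mapMatrix, ← map_sub]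
  change SpecialLinearGroup.toGL g ∈ centGL At ⊔ congGL (ell_le r)
  rw [hgl]
  exact Subgroup.mul_mem_sup hY.symm.eq hD'

end Quotients

/-- The condition that the commutators of `1 + x E` with elements congruent to `s + t A` modulo `π`
impose on `x`, where `A` has trace `τ` and determinant `Δ`, and `E` is a nilpotent matrix with
`trace (A E) = 1`. -/
def CommutatorCondition {R M : Type*} [CommRing R] [Monoid M] (ψ : AddChar R M) (π τ Δ x : R) :
    Prop :=
  ∀ s t, π ∣ normForm τ Δ s t - 1 → π ∣ t * x →
    ψ (x * (normForm τ Δ s t - 1) - s * t * x ^ 2) = 1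

section Condition

variable {𝔬 : Type*} [CommRing 𝔬] [IsLocalRing 𝔬] {r : ℕ}
    {A : Matrix (Fin 2) (Fin 2) (Quo 𝔬 (ell' r))} {At : Matrix (Fin 2) (Fin 2) (Quo 𝔬 r)}

theorem exists_mem_cS_coe_eq_mul {E : Matrix (Fin 2) (Fin 2) (Quo 𝔬 r)} (hdet : E.det = 0)
    (hAE : trace (At * E) = 1) {s t c : Quo 𝔬 r} (hc : red 𝔬 (ell_le r) c = 0)
    (hst : normForm At.trace At.det s t * (1 + c) = 1) :
    ∃ X ∈ cS At, X.1 = (s • 1 + t • At) * (1 + c • (E * At)) := by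
  refine ⟨⟨(s • 1 + t • At) * (1 + c • (E * At)), ?_⟩,
    mem_cS_of_coe_eq_mul rfl (commute_smul_one_add_smul At s t) ?_, rfl⟩
  · rw [det_mul, det_smul_one_add_smul, det_one_add_smul_mul hdet hAE, hst]
  · ext i j
    simp [hc]

theorem commutator_mem_congSL {E : Matrix (Fin 2) (Fin 2) (Quo 𝔬 r)} (htr : E.trace = 0)
    (hdet : E.det = 0) (hAE : trace (At * E) = 1) {x s t c : Quo 𝔬 r}
    (hxt : red 𝔬 (ell_le r) (x * t) = 0) (hc : red 𝔬 (ell_le r) c = 0)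
    {u X : SpecialLinearGroup (Fin 2) (Quo 𝔬 r)} (hu : u.1 = 1 + x • E)
    (hX : X.1 = (s • 1 + t • At) * (1 + c • (E * At))) : ⁅u, X⁆ ∈ congSL (𝔬 := 𝔬) (ell_le r) := by
  have hr : r ≤ ell r + ell r := by unfold ell; omega
  rw [mem_congSL_iff, coe_commutator_sub_one_eq htr hdet hAE
    (mul_eq_zero_of_red _ _ hr hxt hc) (mul_eq_zero_of_red _ _ hr hc hc) hu hX]
  have hxxt : red 𝔬 (ell_le r) (x ^ 2 * t) = 0 := by
    rw [sq, mul_assoc, map_mul, hxt, mul_zero]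
  have hxc : red 𝔬 (ell_le r) (x * c) = 0 := by rw [map_mul, hc, mul_zero]
  rw [Matrix.map_mul, Matrix.map_sub _ (map_sub _), Matrix.map_sub _ (map_sub _),
    Matrix.map_smul' _ _ _ (map_mul _), Matrix.map_smul' _ _ _ (map_mul _),
    Matrix.map_smul' _ _ _ (map_mul _), hxt, hxxt, hxc]
  simp only [zero_smul, sub_zero, zero_mul]

theorem commutatorCondition_of_mem_homStabilizer {ψ : AddChar (Quo 𝔬 r) ℂˣ}
    (hAt : At.map (red 𝔬 (ell'_le r)) = A) (N : NormalForm At) {χ : cS At →* ℂˣ}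
    (hχ : χ ∈ extensions ψ A At) {π x : Quo 𝔬 r} (hπ : red 𝔬 (ell_le r) π = 0)
    (hx : N.unipHom (.ofAdd x) ∈ homStabilizer χ) :
    CommutatorCondition ψ π At.trace At.det x := by
  intro s t hst htx
  have red_eq_zero {y : Quo 𝔬 r} (hy : π ∣ y) : red 𝔬 (ell_le r) y = 0 :=
    zero_dvd_iff.1 (hπ ▸ map_dvd (red 𝔬 (ell_le r)) hy)
  have hr : r ≤ ell r + ell r := by unfold ell; omega
  have hxt : red 𝔬 (ell_le r) (x * t) = 0 := red_eq_zero (mul_comm t x ▸ htx)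
  obtain ⟨c, hst'⟩ : ∃ c, normForm At.trace At.det s t = 1 - c := ⟨_, (sub_sub_cancel _ _).symm⟩
  rw [hst'] at hst ⊢
  have hc : red 𝔬 (ell_le r) c = 0 := red_eq_zero (by rwa [sub_sub_cancel_left, dvd_neg] at hst)
  have hcc : c * c = 0 := mul_eq_zero_of_red _ _ hr hc hc
  obtain ⟨X, hXmem, hX⟩ := exists_mem_cS_coe_eq_mul N.det_nilpotent N.trace_mul_nilpotent hc
    (s := s) (t := t) (by linear_combination (1 + c) * hst' - hcc)
  have hu := N.unipHom_coe x
  have hK := commutator_mem_congSL N.trace_nilpotent N.det_nilpotent N.trace_mul_nilpotent hxt hc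
    hu hX
  have htrace := trace_mul_commutator_sub_one N.trace_nilpotent N.det_nilpotent
    N.trace_mul_nilpotent (mul_eq_zero_of_red _ _ hr hxt hc) hcc hu hX
  calc ψ (x * (1 - c - 1) - s * t * x ^ 2)
    _ = psiLift ψ At ⟨_, hK⟩ := by
      refine congrArg ψ (Eq.trans ?_ htrace.symm)
      linear_combination x * c * hst' - x * hcc
    _ = χ ⟨_, congSL_le_cS At hK⟩ := by rw [← psi_eq_psiLift ψ A At hAt, ← hχ ⟨_, hK⟩]; rfl
    _ = 1 := map_commutator_eq_one hx ⟨X, hXmem⟩ _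

/-- The group of all `x` for which `1 + x • N.nilpotent` stabilizes `χ`. -/
def unipStab (N : NormalForm At) (χ : cS At →* ℂˣ) : AddSubgroup (Quo 𝔬 r) :=
  Subgroup.toAddSubgroup' ((homStabilizer χ).comap N.unipHom)

theorem card_stab_le [Finite (Quo 𝔬 r)] (N : NormalForm At) (χ : cS At →* ℂˣ) {π : Quo 𝔬 r}
    (hπ : red 𝔬 (ell_le r) π = 0) :
    Nat.card (stab N χ) ≤
      Nat.card (cS At) * (Ideal.span {π}).toAddSubgroup.relIndex (unipStab N χ) := by
  refine card_le_card_mul_relIndex (u := N.unipHom) (fun x hx => N.unipHom_mem_cS ?_) ?_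
  · exact zero_dvd_iff.1 (hπ ▸ map_dvd (red 𝔬 (ell_le r)) (Ideal.mem_span_singleton.1 hx))
  · rintro _ ⟨⟨c, hc, _, ⟨x, -, rfl⟩, rfl⟩, hg⟩
    refine ⟨c, hc, x, ?_, rfl⟩
    exact (Subgroup.mul_mem_cancel_left _ (le_homStabilizer χ hc)).1
      (mem_homStabilizer_of_forall hg)

end Condition

section Valuations

variable {R M : Type*} [CommRing R] [Monoid M] {p : R} {ψ : AddChar R M} {r : ℕ}

theorem pow_pred_mul_eq_of_dvd_sub_one (hp : p ^ r = 0) (hr : r ≠ 0) {a : R} (ha : p ∣ a - 1) :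
    p ^ (r - 1) * a = p ^ (r - 1) := by
  obtain ⟨z, hz⟩ := ha
  linear_combination p ^ (r - 1) * hz + z * (pow_sub_one_mul hr p).trans hp

theorem pow_dvd_of_eq_mul_pow {l k : ℕ} (hlk : l ≤ k) {c y : R} (hy : y = c * p ^ k) :
    p ^ l ∣ y :=
  hy ▸ (pow_dvd_pow p hlk).mul_left c

theorem exists_isUnit_sub_eq_mul_pow_min (hp : IsNilpotent p) {u v : R} (hu : IsUnit u)
    (hv : IsUnit v) {m b : ℕ} (h : m ≠ b) :
    ∃ y, IsUnit y ∧ v * p ^ b - u * p ^ m = y * p ^ min m b := by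
  have isUnit_add {w : R} (hw : IsUnit w) (z : R) : IsUnit (w + p * z) :=
    ((Commute.all p z).isNilpotent_mul_right hp).isUnit_add_left_of_commute hw (.all _ _)
  rcases lt_or_gt_of_ne h with h | h
  · obtain ⟨k, rfl⟩ := Nat.exists_eq_add_of_lt h
    refine ⟨-u + p * (v * p ^ k), isUnit_add hu.neg _, ?_⟩
    rw [min_eq_left h.le]
    ring
  · obtain ⟨k, rfl⟩ := Nat.exists_eq_add_of_lt h
    refine ⟨v + p * (-u * p ^ k), isUnit_add hv _, ?_⟩
    rw [min_eq_right h.le]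
    ring

theorem CommutatorCondition.map_mul_eq_one {π τ Δ x y : R} (hx : CommutatorCondition ψ π τ Δ x)
    (hy : π ∣ 2 * y + y ^ 2) : ψ (x * (2 * y + y ^ 2)) = 1 := by
  have hN : normForm τ Δ (1 + y) 0 - 1 = 2 * y + y ^ 2 := by rw [normForm]; ring
  simpa [hN] using hx (1 + y) 0 (by rwa [hN]) (by simp)

theorem CommutatorCondition.ell_le_add_one_of_two_eq (hp : p ^ r = 0) (hψ : ψ (p ^ (r - 1)) ≠ 1)
    {e m : ℕ} (hr : 4 * e ≤ r) {τ Δ ε u : R} (hε : IsUnit ε) (h2 : (2 : R) = ε * p ^ e)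
    (hu : IsUnit u) (hx : CommutatorCondition ψ (p ^ ell r) τ Δ (u * p ^ m)) :
    ell r ≤ m + 1 := by
  by_contra! hm
  unfold ell at *
  obtain ⟨c, hc⟩ := (hu.mul hε).exists_right_inv
  obtain ⟨i, hi⟩ : ∃ i, m + (e + i) = r - 1 := ⟨r - 1 - m - e, by omega⟩
  have hy : 2 * (c * p ^ i) + (c * p ^ i) ^ 2 = ε * c * p ^ (e + i) + c ^ 2 * p ^ (i * 2) := by
    rw [h2]
    ring
  refine hψ (Eq.trans (congrArg ψ ?_) (hx.map_mul_eq_one (y := c * p ^ i) ?_))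
  · have hsq : p ^ (m + i * 2) = 0 := pow_eq_zero_of_le (by omega) hp
    calc p ^ (r - 1) = u * ε * c * p ^ (m + (e + i)) + u * c ^ 2 * p ^ (m + i * 2) := by
          rw [hc, hi, hsq, one_mul, mul_zero, add_zero]
      _ = u * p ^ m * (2 * (c * p ^ i) + (c * p ^ i) ^ 2) := by rw [hy]; ring
  · rw [hy]
    exact dvd_add ((pow_dvd_pow p (by omega)).mul_left _) ((pow_dvd_pow p (by omega)).mul_left _)

theorem exists_dvd_sub_sq_add_mul_sq (h2 : (2 : R) = 0) (hsq : ∀ c : R, ∃ y, p ∣ c - y ^ 2)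
    (a : R) (k : ℕ) : ∃ γ δ, p ^ k ∣ a - (γ ^ 2 + p * δ ^ 2) := by
  induction k with
  | zero => exact ⟨0, 0, by simp⟩
  | succ k ih =>
    obtain ⟨γ, δ, c, hc⟩ := ih
    obtain ⟨y, z, hz⟩ := hsq c
    rcases Nat.even_or_odd' k with ⟨i, rfl | rfl⟩
    · exact ⟨γ + p ^ i * y, δ, z, by linear_combination hc + p ^ (2 * i) * hz - γ * p ^ i * y * h2⟩
    · exact ⟨γ, δ + p ^ i * y, z,
        by linear_combination hc + p ^ (2 * i + 1) * hz - p * δ * p ^ i * y * h2⟩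

theorem exists_dvd_mul_sq_sub_one (hsq : ∀ c : R, ∃ y, p ∣ c - y ^ 2) {u : R} (hu : IsUnit u) :
    ∃ y, p ∣ u * y ^ 2 - 1 := by
  obtain ⟨c, hc⟩ := hu.exists_right_inv
  obtain ⟨y, z, hz⟩ := hsq c
  exact ⟨y, -(u * z), by linear_combination hc - u * hz⟩

theorem CommutatorCondition.mod_two_eq (h2 : (2 : R) = 0) (hsq : ∀ c : R, ∃ y, p ∣ c - y ^ 2)
    (hp : p ^ r = 0) (hψ : ψ (p ^ (r - 1)) ≠ 1) {m : ℕ} {τ Δ u : R} (hu : IsUnit u)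
    (hx : CommutatorCondition ψ (p ^ ell r) τ Δ (u * p ^ m)) (hm : m < ell' r) :
    m % 2 = r % 2 := by
  by_contra hmr
  unfold ell ell' at *
  obtain ⟨j, hj⟩ : ∃ j, m + j * 2 = r - 1 := ⟨(r - 1 - m) / 2, by omega⟩
  obtain ⟨c, hc⟩ := exists_dvd_mul_sq_sub_one hsq hu
  have hy : 2 * (c * p ^ j) + (c * p ^ j) ^ 2 = c ^ 2 * p ^ (j * 2) := by
    rw [h2]
    ring
  refine hψ (Eq.trans (congrArg ψ ?_) (hx.map_mul_eq_one (y := c * p ^ j) ?_))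
  · rw [← pow_pred_mul_eq_of_dvd_sub_one hp (by omega) hc, hy, ← hj]
    ring
  · rw [hy]
    exact (pow_dvd_pow p (by omega)).mul_left _

theorem CommutatorCondition.map_add_eq_one (h2 : (2 : R) = 0) {π τ γ δ x t : R}
    (hx : CommutatorCondition ψ π τ (γ ^ 2 + p * δ ^ 2) x) (htτ : π ∣ t * τ)
    (htδ : π ∣ p * δ ^ 2 * t ^ 2) (htx : π ∣ t * x) :
    ψ (p * δ ^ 2 * t ^ 2 * x + (1 + γ * t) * t * x * (τ - x)) = 1 := by
  have hN : normForm τ (γ ^ 2 + p * δ ^ 2) (1 + γ * t) t - 1 =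
      (1 + γ * t) * (t * τ) + p * δ ^ 2 * t ^ 2 := by
    rw [normForm]
    linear_combination (γ * t + γ ^ 2 * t ^ 2) * h2
  rw [← hx (1 + γ * t) t (hN ▸ dvd_add (htτ.mul_left _) htδ) htx, hN]
  ring_nf

theorem CommutatorCondition.le_add_min (h2 : (2 : R) = 0) (hp : p ^ r = 0)
    (hψ : ψ (p ^ (r - 1)) ≠ 1) {m b d : ℕ} {γ δ v u : R} (hu : IsUnit u) (hv : IsUnit v)
    (hx : CommutatorCondition ψ (p ^ ell r) (v * p ^ b) (γ ^ 2 + p * (δ * p ^ d) ^ 2) (u * p ^ m))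
    (hm : m < ell' r) (hmb : m ≠ b) : r + 2 * d ≤ m + 2 * min m b := by
  by_contra! hlt
  obtain ⟨y, hy, hsub⟩ := exists_isUnit_sub_eq_mul_pow_min ⟨r, hp⟩ hu hv hmb
  obtain ⟨c, hc⟩ := (hu.mul hy).exists_right_inv
  unfold ell ell' at *
  obtain ⟨j, hj⟩ : ∃ j, j + m + min m b = r - 1 := ⟨r - 1 - (m + min m b), by omega⟩
  have hu' : p ∣ (1 + γ * (c * p ^ j)) * c * u * y - 1 := by
    obtain ⟨i, rfl⟩ : ∃ i, j = i + 1 := ⟨j - 1, by omega⟩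
    exact ⟨γ * c * p ^ i, by linear_combination (1 + γ * (c * p ^ (i + 1))) * hc⟩
  have hδ : p ^ (1 + d * 2 + j * 2 + m) = 0 := pow_eq_zero_of_le (by omega) hp
  refine hψ (Eq.trans (congrArg ψ ?_) (hx.map_add_eq_one h2 (t := c * p ^ j) ?_ ?_ ?_))
  · rw [hsub, ← pow_pred_mul_eq_of_dvd_sub_one hp (by omega) hu', ← hj]
    linear_combination -(δ ^ 2 * c ^ 2 * u) * hδ
  · exact pow_dvd_of_eq_mul_pow (c := c * v) (k := j + b) (by omega) (by ring)
  · exact pow_dvd_of_eq_mul_pow (c := δ ^ 2 * c ^ 2) (k := 1 + d * 2 + j * 2) (by omega) (by ring)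
  · exact pow_dvd_of_eq_mul_pow (c := c * u) (k := j + m) (by omega) (by ring)

theorem CommutatorCondition.add_min_le (h2 : (2 : R) = 0) (hsq : ∀ c : R, ∃ y, p ∣ c - y ^ 2)
    (hp : p ^ r = 0) (hψ : ψ (p ^ (r - 1)) ≠ 1) {m b d : ℕ} {γ δ v u : R} (hu : IsUnit u)
    (hδ : IsUnit δ)
    (hx : CommutatorCondition ψ (p ^ ell r) (v * p ^ b) (γ ^ 2 + p * (δ * p ^ d) ^ 2) (u * p ^ m))
    (hm : m < ell' r) : m + 2 * min m b ≤ r + 2 * d := by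
  by_contra! hlt
  have hmr := hx.mod_two_eq h2 hsq hp hψ hu hm
  obtain ⟨y, hsub⟩ : p ^ min m b ∣ v * p ^ b - u * p ^ m :=
    dvd_sub ((pow_dvd_pow p (min_le_right m b)).mul_left v)
      ((pow_dvd_pow p (min_le_left m b)).mul_left u)
  obtain ⟨c, hc⟩ := exists_dvd_mul_sq_sub_one hsq (hu.mul (hδ.pow 2))
  unfold ell ell' at *
  obtain ⟨j, hj⟩ : ∃ j, 1 + d * 2 + j * 2 + m = r - 1 := ⟨(r - 2 - m) / 2 - d, by omega⟩
  have hy : p ^ (j + m + min m b) = 0 := pow_eq_zero_of_le (by omega) hp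
  refine hψ (Eq.trans (congrArg ψ ?_) (hx.map_add_eq_one h2 (t := c * p ^ j) ?_ ?_ ?_))
  · rw [hsub, ← pow_pred_mul_eq_of_dvd_sub_one hp (by omega) hc, ← hj]
    linear_combination -((1 + γ * (c * p ^ j)) * c * u * y) * hy
  · exact pow_dvd_of_eq_mul_pow (c := c * v) (k := j + b) (by omega) (by ring)
  · exact pow_dvd_of_eq_mul_pow (c := δ ^ 2 * c ^ 2) (k := 1 + d * 2 + j * 2) (by omega) (by ring)
  · exact pow_dvd_of_eq_mul_pow (c := c * u) (k := j + m) (by omega) (by ring)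

theorem card_filter_add_two_mul_min_le_one (s : Finset ℕ) (b c : ℕ) :
    #{m ∈ s | m + 2 * min m b = c} ≤ 1 :=
  card_le_one.2 fun m hm n hn => by
    have h1 := (mem_filter.1 hm).2
    have h2 := (mem_filter.1 hn).2
    omega

theorem relIndex_le_of_two_eq [Finite R] (hfac : ∀ y : R, ∃ u n, IsUnit u ∧ y = u * p ^ n)
    (hp : p ^ r = 0) (hψ : ψ (p ^ (r - 1)) ≠ 1) {e : ℕ} (hr : 4 * e ≤ r) {τ Δ ε : R}
    (hε : IsUnit ε) (h2 : (2 : R) = ε * p ^ e) {T : AddSubgroup R}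
    (hT : ∀ x ∈ T, CommutatorCondition ψ (p ^ ell r) τ Δ x) :
    (Ideal.span {p ^ ell r}).toAddSubgroup.relIndex T ≤ (Ideal.span {p}).toAddSubgroup.index := by
  have hV : ∀ m < ell r, ∀ u, IsUnit u → u * p ^ m ∈ T → m ∈ ({ell r - 1} : Finset ℕ) := by
    intro m hm u hu hx
    have := (hT _ hx).ell_le_add_one_of_two_eq hp hψ hr hε h2 hu
    exact mem_singleton.2 (by omega)
  simpa using relIndex_span_pow_le_pow_card hfac hV

theorem relIndex_le_of_two_eq_zero [Finite R] (hfac : ∀ y : R, ∃ u n, IsUnit u ∧ y = u * p ^ n)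
    (h2 : (2 : R) = 0) (hsq : ∀ c : R, ∃ y, p ∣ c - y ^ 2) (hp : p ^ r = 0)
    (hψ : ψ (p ^ (r - 1)) ≠ 1) {τ Δ : R} {T : AddSubgroup R}
    (hT : ∀ x ∈ T, CommutatorCondition ψ (p ^ ell r) τ Δ x) :
    (Ideal.span {p ^ ell r}).toAddSubgroup.relIndex T ≤
      (Ideal.span {p}).toAddSubgroup.index ^ 3 := by
  obtain ⟨γ, δ, hΔ⟩ := exists_dvd_sub_sq_add_mul_sq h2 hsq Δ r
  rw [hp, zero_dvd_iff, sub_eq_zero] at hΔ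
  obtain ⟨δ, d, hδ, rfl⟩ := hfac δ
  obtain ⟨v, b, hv, rfl⟩ := hfac τ
  rw [hΔ] at hT
  refine (relIndex_span_pow_le_pow_card hfac (V := insert (ell r - 1) (insert b
    {m ∈ range (ell r) | m + 2 * min m b = r + 2 * d})) fun m hm u hu hx => ?_).trans
    (Nat.pow_le_pow_right (Nat.pos_of_ne_zero AddSubgroup.FiniteIndex.index_ne_zero) ?_)
  · simp only [mem_insert, mem_filter, mem_range]
    by_cases hml : m < ell' r
    · by_cases hmb : m = b
      · exact .inr (.inl hmb)
      · exact .inr (.inr ⟨hm, ((hT _ hx).add_min_le h2 hsq hp hψ hu hδ hml).antisymm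
          ((hT _ hx).le_add_min h2 hp hψ hu hv hml hmb)⟩)
    · left
      unfold ell ell' at *
      omega
  · exact (card_insert_le _ _).trans (Nat.succ_le_succ ((card_insert_le _ _).trans
      (Nat.succ_le_succ (card_filter_add_two_mul_min_le_one _ _ _))))

end Valuations

section ResidueRings

variable {𝔬 : Type*} [CommRing 𝔬] [IsLocalRing 𝔬] {ϖ : 𝔬} {r : ℕ}

theorem index_span_le_card_residueField [Finite (ResidueField 𝔬)]
    (hϖ : maximalIdeal 𝔬 = Ideal.span {ϖ}) :
    (Ideal.span {(Ideal.Quotient.mk _ ϖ : Quo 𝔬 r)}).toAddSubgroup.index ≤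
      Nat.card (ResidueField 𝔬) := by
  let f : 𝔬 →+ Quo 𝔬 r := (Ideal.Quotient.mk (maximalIdeal 𝔬 ^ r)).toAddMonoidHom
  rw [← AddSubgroup.index_comap_of_surjective (f := f) _ Ideal.Quotient.mk_surjective]
  refine Nat.le_of_dvd Nat.card_pos
    (AddSubgroup.index_dvd_of_le (H := (maximalIdeal 𝔬).toAddSubgroup) fun x hx => ?_)
  obtain ⟨c, rfl⟩ := Ideal.mem_span_singleton.1 (hϖ ▸ hx : x ∈ Ideal.span {ϖ})
  exact Ideal.mem_span_singleton.2 (map_dvd (Ideal.Quotient.mk _) ⟨c, rfl⟩)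

theorem exists_mk_dvd_sub_sq [Finite (ResidueField 𝔬)] (hϖ : maximalIdeal 𝔬 = Ideal.span {ϖ})
    (h2 : (2 : 𝔬) = 0) (c : Quo 𝔬 r) : ∃ y, Ideal.Quotient.mk _ ϖ ∣ c - y ^ 2 := by
  have : CharP (ResidueField 𝔬) 2 := CharTwo.of_one_ne_zero_of_two_eq_zero one_ne_zero <| by
    rw [← map_ofNat (residue 𝔬), h2, map_zero]
  obtain ⟨c, rfl⟩ := Ideal.Quotient.mk_surjective c
  obtain ⟨y, hy⟩ := FiniteField.isSquare_of_char_two (ringChar.eq _ 2) (residue 𝔬 c)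
  obtain ⟨y, rfl⟩ := residue_surjective y
  have hcy : c - y ^ 2 ∈ Ideal.span {ϖ} := by
    rw [← hϖ, ← residue_eq_zero_iff, map_sub, map_pow, hy, sq, sub_self]
  refine ⟨Ideal.Quotient.mk _ y, ?_⟩
  rw [← map_pow, ← map_sub]
  exact map_dvd _ (Ideal.mem_span_singleton.1 hcy)

theorem red_mk_pow_eq_zero (hϖ : ϖ ∈ maximalIdeal 𝔬) {i : ℕ} (h : i ≤ r) :
    red 𝔬 h (Ideal.Quotient.mk _ ϖ ^ i) = 0 := by
  rw [← map_pow, red_eq_zero_iff]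
  exact Ideal.pow_mem_pow hϖ i

theorem mk_pow_eq_zero (hϖ : ϖ ∈ maximalIdeal 𝔬) (r : ℕ) :
    (Ideal.Quotient.mk _ ϖ ^ r : Quo 𝔬 r) = 0 := by
  rw [← map_pow, Ideal.Quotient.eq_zero_iff_mem]
  exact Ideal.pow_mem_pow hϖ r

theorem finite_quo [IsNoetherianRing 𝔬] [Finite (ResidueField 𝔬)] (r : ℕ) : Finite (Quo 𝔬 r) :=
  have : Finite (𝔬 ⧸ maximalIdeal 𝔬) := inferInstanceAs (Finite (ResidueField 𝔬))
  Ideal.finite_quotient_pow (IsNoetherian.noetherian _) r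

end ResidueRings

section DiscreteValuationRing

variable {𝔬 : Type*} [CommRing 𝔬] [IsDomain 𝔬] [IsDiscreteValuationRing 𝔬] {ϖ : 𝔬} {r : ℕ}

theorem exists_eq_isUnit_mul_mk_pow (hϖ : Irreducible ϖ) (y : Quo 𝔬 r) :
    ∃ u n, IsUnit u ∧ y = u * Ideal.Quotient.mk _ ϖ ^ n := by
  obtain ⟨y, rfl⟩ := Ideal.Quotient.mk_surjective y
  obtain rfl | hy := eq_or_ne y 0
  · refine ⟨1, r, isUnit_one, ?_⟩
    rw [mk_pow_eq_zero ((mem_maximalIdeal ϖ).2 hϖ.not_isUnit), map_zero, mul_zero]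
  · obtain ⟨n, hn⟩ := IsDiscreteValuationRing.associated_pow_irreducible hy hϖ
    obtain ⟨u, rfl⟩ := hn.symm
    exact ⟨Ideal.Quotient.mk _ u, n, u.isUnit.map _, by rw [map_mul, map_pow, mul_comm]⟩

theorem exists_two_eq_mul_pow_ramIndex (hϖ : Irreducible ϖ) (h2 : (2 : 𝔬) ≠ 0) :
    ∃ ε : 𝔬, IsUnit ε ∧ 2 = ε * ϖ ^ ramIndex 𝔬 := by
  have hspan (n : ℕ) :
      Ideal.span {(2 : 𝔬)} = maximalIdeal 𝔬 ^ n ↔ Associated (2 : 𝔬) (ϖ ^ n) := by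
    rw [hϖ.maximalIdeal_eq, Ideal.span_singleton_pow, Ideal.span_singleton_eq_span_singleton]
  obtain ⟨n, hn⟩ := IsDiscreteValuationRing.associated_pow_irreducible h2 hϖ
  have hram : Ideal.span {(2 : 𝔬)} = maximalIdeal 𝔬 ^ ramIndex 𝔬 :=
    Nat.sInf_mem (s := {e | Ideal.span {(2 : 𝔬)} = maximalIdeal 𝔬 ^ e}) ⟨n, (hspan n).2 hn⟩
  obtain ⟨u, hu⟩ := ((hspan _).1 hram).symm
  exact ⟨u, u.isUnit, by rw [← hu, mul_comm]⟩

theorem two_eq_zero_or_isUnit_two (h : ringChar 𝔬 ≠ 0) : (2 : 𝔬) = 0 ∨ IsUnit (2 : 𝔬) := by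
  have hp : (ringChar 𝔬).Prime := (CharP.char_is_prime_or_zero 𝔬 _).resolve_right h
  refine or_iff_not_imp_right.2 fun h2 => ?_
  have := (CharP.isUnit_natCast_iff (R := 𝔬) (n := 2) hp).not_left.1 (by simpa using h2)
  exact_mod_cast (CharP.cast_eq_zero_iff 𝔬 (ringChar 𝔬) 2).2 this

variable [Finite (ResidueField 𝔬)] {ψ : AddChar (Quo 𝔬 r) ℂˣ}
  {A : Matrix (Fin 2) (Fin 2) (Quo 𝔬 (ell' r))} {At : Matrix (Fin 2) (Fin 2) (Quo 𝔬 r)}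
  {χ : cS At →* ℂˣ}

theorem card_stab_le_of_two_eq (hϖ : Irreducible ϖ)
    (hψ : ψ (Ideal.Quotient.mk _ (ϖ ^ (r - 1))) ≠ 1) {e : ℕ} (hr : 4 * e ≤ r) {ε : 𝔬}
    (hε : IsUnit ε) (h2 : 2 = ε * ϖ ^ e) (hAt : At.map (red 𝔬 (ell'_le r)) = A)
    (N : NormalForm At) (hχ : χ ∈ extensions ψ A At) :
    Nat.card (stab N χ) ≤ Nat.card (cS At) * Nat.card (ResidueField 𝔬) := by
  have := finite_quo (𝔬 := 𝔬) r
  have hϖ' : ϖ ∈ maximalIdeal 𝔬 := (mem_maximalIdeal ϖ).2 hϖ.not_isUnit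
  have hπ := red_mk_pow_eq_zero hϖ' (ell_le r)
  have h2' : (2 : Quo 𝔬 r) = Ideal.Quotient.mk _ ε * Ideal.Quotient.mk _ ϖ ^ e := by
    rw [← map_pow, ← map_mul, ← h2, map_ofNat]
  have hT (x) (hx : x ∈ unipStab N χ) : CommutatorCondition ψ _ At.trace At.det x :=
    commutatorCondition_of_mem_homStabilizer hAt N hχ hπ hx
  exact (card_stab_le N χ hπ).trans (Nat.mul_le_mul_left _
    ((relIndex_le_of_two_eq (exists_eq_isUnit_mul_mk_pow hϖ) (mk_pow_eq_zero hϖ' r)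
      (by rwa [← map_pow]) hr (hε.map _) h2' hT).trans
      (index_span_le_card_residueField hϖ.maximalIdeal_eq)))

theorem card_stab_le_of_two_eq_zero (hϖ : Irreducible ϖ)
    (hψ : ψ (Ideal.Quotient.mk _ (ϖ ^ (r - 1))) ≠ 1) (h2 : (2 : 𝔬) = 0)
    (hAt : At.map (red 𝔬 (ell'_le r)) = A) (N : NormalForm At) (hχ : χ ∈ extensions ψ A At) :
    Nat.card (stab N χ) ≤ Nat.card (cS At) * Nat.card (ResidueField 𝔬) ^ 3 := by
  have := finite_quo (𝔬 := 𝔬) r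
  have hϖ' : ϖ ∈ maximalIdeal 𝔬 := (mem_maximalIdeal ϖ).2 hϖ.not_isUnit
  have hπ := red_mk_pow_eq_zero hϖ' (ell_le r)
  have h2' : (2 : Quo 𝔬 r) = 0 := by rw [← map_ofNat (Ideal.Quotient.mk _), h2, map_zero]
  have hT (x) (hx : x ∈ unipStab N χ) : CommutatorCondition ψ _ At.trace At.det x :=
    commutatorCondition_of_mem_homStabilizer hAt N hχ hπ hx
  exact (card_stab_le N χ hπ).trans (Nat.mul_le_mul_left _
    ((relIndex_le_of_two_eq_zero (exists_eq_isUnit_mul_mk_pow hϖ) h2'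
      (exists_mk_dvd_sub_sq hϖ.maximalIdeal_eq h2) (mk_pow_eq_zero hϖ' r)
      (by rwa [← map_pow]) hT).trans
      (Nat.pow_le_pow_left (index_span_le_card_residueField hϖ.maximalIdeal_eq) 3)))

end DiscreteValuationRing

end SLTwo

theorem mainTheorem5_general {𝔬 : Type*} [CommRing 𝔬] [IsDomain 𝔬] [IsDiscreteValuationRing 𝔬]
    [Finite (IsLocalRing.ResidueField 𝔬)]
    (r : ℕ) (hr : ringChar 𝔬 = 0 → 4 * SLTwo.ramIndex 𝔬 ≤ r)
    (ϖ : 𝔬) (hϖ : Irreducible ϖ)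
    (ψ : AddChar (SLTwo.Quo 𝔬 r) ℂˣ)
    (hψ : ψ (Ideal.Quotient.mk _ (ϖ ^ (r - 1))) ≠ 1)
    (A : Matrix (Fin 2) (Fin 2) (SLTwo.Quo 𝔬 (SLTwo.ell' r)))
    (At : Matrix (Fin 2) (Fin 2) (SLTwo.Quo 𝔬 r))
    (hAt : At.map (SLTwo.red 𝔬 (SLTwo.ell'_le r)) = A)
    (N : SLTwo.NormalForm At)
    (χ : SLTwo.cS At →* ℂˣ) (hχ : χ ∈ SLTwo.extensions ψ A At) :
    (Nat.card (SLTwo.stab N χ) : ℝ) / (Nat.card (SLTwo.cS At) : ℝ) ≤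
      (Nat.card (IsLocalRing.ResidueField 𝔬) : ℝ) ^ 3 := by
  suffices hcard : Nat.card (SLTwo.stab N χ) ≤
      Nat.card (SLTwo.cS At) * Nat.card (IsLocalRing.ResidueField 𝔬) ^ 3 from
    div_le_of_le_mul₀ (Nat.cast_nonneg _) (by positivity) (by rw [mul_comm]; exact_mod_cast hcard)
  by_cases h2 : (2 : 𝔬) = 0
  · exact SLTwo.card_stab_le_of_two_eq_zero hϖ hψ h2 hAt N hχ
  · obtain ⟨ε, e, hε, h2e, her⟩ : ∃ (ε : 𝔬) (e : ℕ), IsUnit ε ∧ 2 = ε * ϖ ^ e ∧ 4 * e ≤ r := by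
      by_cases hchar : ringChar 𝔬 = 0
      · obtain ⟨ε, hε, h2e⟩ := SLTwo.exists_two_eq_mul_pow_ramIndex hϖ h2
        exact ⟨ε, _, hε, h2e, hr hchar⟩
      · exact ⟨2, 0, (SLTwo.two_eq_zero_or_isUnit_two hchar).resolve_left h2, by simp, by simp⟩
    refine (SLTwo.card_stab_le_of_two_eq hϖ hψ her hε h2e hAt N hχ).trans ?_
    exact Nat.mul_le_mul_left _ (Nat.le_self_pow (by decide) _)

theorem mainTheorem5 {𝔬 : Type*} [CommRing 𝔬] [IsDomain 𝔬] [IsDiscreteValuationRing 𝔬]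
    [IsAdicComplete (IsLocalRing.maximalIdeal 𝔬) 𝔬]
    [Finite (IsLocalRing.ResidueField 𝔬)] [CharP (IsLocalRing.ResidueField 𝔬) 2]
    (r : ℕ) (hr : SLTwo.levelBound 𝔬 ≤ r)
    (ϖ : 𝔬) (hϖ : Irreducible ϖ)
    (ψ : AddChar (SLTwo.Quo 𝔬 r) ℂˣ)
    (hψ : ψ (Ideal.Quotient.mk _ (ϖ ^ (r - 1))) ≠ 1)
    (A : Matrix (Fin 2) (Fin 2) (SLTwo.Quo 𝔬 (SLTwo.ell' r))) (hA : SLTwo.IsCyclicMat A)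
    (At : Matrix (Fin 2) (Fin 2) (SLTwo.Quo 𝔬 r))
    (hAt : At.map (SLTwo.red 𝔬 (SLTwo.ell'_le r)) = A)
    (N : SLTwo.NormalForm At)
    (χ : SLTwo.cS At →* ℂˣ) (hχ : χ ∈ SLTwo.extensions ψ A At) :
    (Nat.card (SLTwo.stab N χ) : ℝ) / (Nat.card (SLTwo.cS At) : ℝ) ≤
      (Nat.card (IsLocalRing.ResidueField 𝔬) : ℝ) ^ 3 :=
  mainTheorem5_general r (fun h => by rwa [SLTwo.levelBound, if_pos h] at hr)
    ϖ hϖ ψ hψ A At hAt N χ hχ
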